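/- Let $d=4n+3$ be a prime (with $n\ge 0$ an integer), let $(e_r)_{r\in\mathbb{Z}_d}$ be the standard basis of $\mathbb{C}^d$, and put $\tau=e^{i\pi(d+1)/d}$. Let $U,V$ be the $d\times d$ matrices with $Ue_r=e^{2\pi i r/d}e_r$ and $Ve_r=e_{r+1}$ (indices modulo $d$), let $W_{(r,s)}=\tau^{rs}V^rU^s$ for $0\le r,s\le d-1$ be the Weyl–Heisenberg matrices, and let $$R_m=\frac1d\sum_{r=0}^{d-1}\sum_{s=0}^{d-1}\tau^{m(r^2+s^2)}W_{(r,s)},\qquad 0\le m\le d-1 .$$ The matrices $R_0,\dots,R_{d-1}$ have a common orthonormal basis of eigenvectors $\psi_0,\dots,\psi_{d-1}$ (the Balian–Itzykson basis), which is unique up to the order of the vectors and multiplication of each of them by a complex number of modulus $1$. Let $P_i=|\psi_i\rangle\langle\psi_i|$ be the corresponding rank one projection matrices, and let $$P_i^{(k,l)}=W_{(k,l)}\,P_i\,W_{(k,l)}^{-1},\qquad 0\le i,k,l\le d-1 .$$ Then every complex $d\times d$ matrix $\rho$ with $\operatorname{tr}\rho=1$ satisfies $$\rho=(d+1)\sum_{i=0}^{d-1}\sum_{k=0}^{d-1}\sum_{l=0}^{d-1}\rho_i^{(k,l)}\,P_i^{(k,l)}-I,\qquad\text{where}\quad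 \rho_i^{(k,l)}=\frac1{d^2}\operatorname{tr}\bigl(\rho P_i^{(k,l)}\bigr).$$ -/

import Mathlib

open scoped Matrix

noncomputable section

namespace BalianItzykson

/-- The phase `τ = e^{iπ(d+1)/d}`; for odd `d` it is a primitive `d`-th root of unity. -/
def tau (d : ℕ) : ℂ :=
  Complex.exp (Complex.I * (Real.pi : ℂ) * ((d : ℂ) + 1) / (d : ℂ))

/-- The clock matrix: `U e_r = e^{2πir/d} e_r`. -/
def clock (d : ℕ) : Matrix (ZMod d) (ZMod d) ℂ :=
  Matrix.diagonal fun r =>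
    Complex.exp (Complex.I * 2 * (Real.pi : ℂ) * (r.val : ℂ) / (d : ℂ))

/-- The shift matrix: `V e_r = e_{r+1}`, indices modulo `d`. -/
def shift (d : ℕ) : Matrix (ZMod d) (ZMod d) ℂ :=
  Matrix.of fun q r => if q = r + 1 then 1 else 0

/-- The Weyl–Heisenberg matrix `W_(r,s) = τ^{rs} V^r U^s`, with `0 ≤ r, s ≤ d - 1`. -/
def weyl (d : ℕ) [NeZero d] (r s : ZMod d) : Matrix (ZMod d) (ZMod d) ℂ :=
  tau d ^ (r.val * s.val) • (shift d ^ r.val * clock d ^ s.val)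

/-- `R_m = (1/d) ∑_{r,s} τ^{m(r² + s²)} W_(r,s)`. -/
def rMat (d : ℕ) [NeZero d] (m : ℕ) : Matrix (ZMod d) (ZMod d) ℂ :=
  (1 / (d : ℂ)) • ∑ r : ZMod d, ∑ s : ZMod d,
    tau d ^ (m * (r.val ^ 2 + s.val ^ 2)) • weyl d r s

/-- `ψ` is an orthonormal basis of `ℂ^d` consisting of common eigenvectors of the `d` matrices
`R_0, …, R_{d-1}`. -/
def IsCommonEigenbasis (d : ℕ) [NeZero d]
    (ψ : OrthonormalBasis (Fin d) ℂ (EuclideanSpace ℂ (ZMod d))) : Prop :=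
  ∀ m < d, ∀ i : Fin d, ∃ μ : ℂ,
    Module.End.HasEigenvector (Matrix.toEuclideanLin (rMat d m)) μ (ψ i)

/-- The rank one projection matrix `|v⟩⟨v|` (`v` a unit vector). -/
def proj {d : ℕ} (v : EuclideanSpace ℂ (ZMod d)) : Matrix (ZMod d) (ZMod d) ℂ :=
  Matrix.of fun q r => v q * star (v r)

/-- The translate `W_(k,l) |v⟩⟨v| W_(k,l)⁻¹`. -/
def projTranslate {d : ℕ} [NeZero d] (v : EuclideanSpace ℂ (ZMod d)) (k l : ZMod d) :
    Matrix (ZMod d) (ZMod d) ℂ :=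
  weyl d k l * proj v * (weyl d k l)⁻¹

end BalianItzykson

end

/-! Let `n_N` be the number of points `a` of phase space with `r² + s² = N`, and `T_N` the sum of
the `W_a` over them. By Fourier inversion the `T_N` and the `R_m` span the same space. The `T_N` are
Hermitian, commute (`radial_mul_comm`) and satisfy `tr (T_M T_N) = d n_N δ_MN`, so their `d × d`
eigenvalue table `lam` is invertible. Hence each `P_i` is itself a combination of the `T_N`
(`IsLevelEigenvalue.proj_eq_radial`), which gives uniqueness.

Conjugating by all `W_k` and summing removes the cross terms (`sum_conj_radial`); summing over `i`
then gives `tr (ρ W_{-a}) W_a` the weight `1 / (d n_N)`. As `d ≡ 3 mod 4`, the form is anisotropic,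
so `n_0 = 1` and every other `n_N = d + 1`. The triple sum is therefore `(ρ + I) / (d + 1)`. -/

noncomputable section

namespace BalianItzykson

/-! ### Phases and Weyl–Heisenberg matrices -/

/-- The additive character `χ` of `ZMod d` with `χ 2 = e^{2πi/d}`, so that `χ 1 = τ` for odd `d`. -/
def phase (d : ℕ) [NeZero d] : AddChar (ZMod d) ℂ :=
  AddChar.mulShift ZMod.stdAddChar (2⁻¹ : ZMod d)

/-- The integer `(d + 1) / 2` represents `2⁻¹` modulo `d`, so exponents of `τ` can be handled in
`ZMod d`. -/
theorem tau_pow {d : ℕ} [NeZero d] (hd : d % 4 = 3) (n : ℕ) : tau d ^ n = phase d n := by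
  have hd0 : (d : ℂ) ≠ 0 := Nat.cast_ne_zero.2 (NeZero.ne d)
  have h2 : (2 : ZMod d)⁻¹ = ((((d + 1) / 2 : ℕ) : ℤ) : ZMod d) := by
    have hc : Nat.Coprime 2 d := (Nat.coprime_two_left).2 (Nat.odd_iff.2 (by omega))
    have h : (2 : ZMod d) * (((d + 1) / 2 : ℕ) : ZMod d) = 1 := by
      have : 2 * ((d + 1) / 2) = d + 1 := by omega
      have := congrArg (Nat.cast (R := ZMod d)) this
      simpa using this
    have hc' := ZMod.coe_mul_inv_eq_one 2 hc
    have hu : IsUnit (2 : ZMod d) := IsUnit.of_mul_eq_one _ h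
    apply hu.mul_left_cancel
    rw [Int.cast_natCast, h]
    exact_mod_cast hc'
  have h1 : tau d = phase d 1 := by
    rw [phase, AddChar.mulShift_apply, mul_one, h2, ZMod.stdAddChar_coe, tau]
    congr 1
    have : ((((d + 1) / 2 : ℕ) : ℤ) : ℂ) = ((d : ℂ) + 1) / 2 := by
      have : 2 * ((d + 1) / 2) = d + 1 := by omega
      have := congrArg (Nat.cast (R := ℂ)) this
      rw [Int.cast_natCast, eq_div_iff two_ne_zero, mul_comm]
      exact_mod_cast this
    rw [this]; ring
  rw [h1, ← AddChar.map_nsmul_eq_pow, nsmul_one]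

theorem two_ne_zero_zmod {d : ℕ} [Fact d.Prime] (hd : d % 4 = 3) : (2 : ZMod d) ≠ 0 := by
  intro h
  have h' : ((2 : ℕ) : ZMod d) = 0 := by exact_mod_cast h
  have := Nat.le_of_dvd (by norm_num) ((ZMod.natCast_eq_zero_iff 2 d).1 h')
  have := (Fact.out : d.Prime).two_le
  omega

theorem phase_isPrimitive {d : ℕ} [Fact d.Prime] (hd : d % 4 = 3) : (phase d).IsPrimitive := by
  intro a ha
  rw [phase, AddChar.mulShift_mulShift]
  exact ZMod.isPrimitive_stdAddChar d
    (mul_ne_zero (inv_ne_zero (two_ne_zero_zmod hd)) ha)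

theorem sum_phase_mul {d : ℕ} [Fact d.Prime] (hd : d % 4 = 3) (b : ZMod d) :
    ∑ x, phase d (x * b) = if b = 0 then (d : ℂ) else 0 := by
  rw [AddChar.sum_mulShift b (phase_isPrimitive hd)]
  split_ifs <;> simp [ZMod.card]

theorem conj_phase {d : ℕ} [NeZero d] (a : ZMod d) : star (phase d a) = phase d (-a) :=
  (AddChar.map_neg_eq_conj _ _).symm

theorem clock_eq {d : ℕ} [Fact d.Prime] (hd : d % 4 = 3) :
    clock d = Matrix.diagonal fun r => phase d (2 * r) := by
  unfold clock
  congr 1; ext r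
  rw [phase, AddChar.mulShift_apply, inv_mul_cancel_left₀ (two_ne_zero_zmod hd)]
  conv_rhs => rw [← ZMod.natCast_zmod_val r, ← Int.cast_natCast, ZMod.stdAddChar_coe]
  congr 1
  push_cast; ring

theorem shift_pow_apply {d : ℕ} [NeZero d] (n : ℕ) (q t : ZMod d) :
    (shift d ^ n) q t = if q = t + n then 1 else 0 := by
  induction n generalizing q t with
  | zero => simp [Matrix.one_apply]
  | succ n ih =>
    rw [pow_succ, Matrix.mul_apply, Finset.sum_eq_single (t + 1)]
    · rw [ih]; simp [shift, add_comm, add_left_comm]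
    · intro b _ hb; simp [shift, hb]
    · simp

/-- The Weyl–Heisenberg matrix attached to a point of the discrete phase space. -/
def weylAt {d : ℕ} [NeZero d] (a : ZMod d × ZMod d) :
    Matrix (ZMod d) (ZMod d) ℂ :=
  Matrix.of fun q t => if a.1 = q - t then phase d (a.2 * (q + t)) else 0

theorem weylAt_apply {d : ℕ} [NeZero d] (a : ZMod d × ZMod d) (q t : ZMod d) :
    weylAt a q t = if a.1 = q - t then phase d (a.2 * (q + t)) else 0 := rfl

/-- On the support `q = t + r`, the exponent `rs + 2ts` equals `s (q + t)`, which is symmetric in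
row and column. -/
theorem weyl_eq_weylAt {d : ℕ} [Fact d.Prime] (hd : d % 4 = 3) (r s : ZMod d) :
    weyl d r s = weylAt (r, s) := by
  ext q t
  rw [weyl, tau_pow hd, clock_eq hd, Matrix.diagonal_pow, Matrix.smul_apply,
    Matrix.mul_diagonal, shift_pow_apply, weylAt_apply]
  simp only [Nat.cast_mul, ZMod.natCast_zmod_val, Pi.pow_apply, ← AddChar.map_nsmul_eq_pow,
    nsmul_eq_mul, smul_eq_mul, ite_mul, one_mul, zero_mul, mul_ite, mul_zero,
    ← AddChar.map_add_eq_mul]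
  have : q = t + r ↔ r = q - t := by rw [eq_sub_iff_add_eq, add_comm, eq_comm]
  simp only [this]
  split_ifs with h
  · subst h; congr 1; ring
  · rfl

/-- The symplectic form of the discrete phase space. -/
def symp {d : ℕ} (a b : ZMod d × ZMod d) : ZMod d := a.2 * b.1 - a.1 * b.2

theorem weylAt_mul {d : ℕ} [NeZero d] (a b : ZMod d × ZMod d) :
    weylAt a * weylAt b = phase d (symp a b) • weylAt (a + b) := by
  ext q t
  rw [Matrix.mul_apply, Matrix.smul_apply, Finset.sum_eq_single (t + b.1)]
  · simp only [weylAt_apply, add_sub_cancel_left, if_true, Prod.fst_add, Prod.snd_add, symp,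
      ite_mul, zero_mul, smul_eq_mul, mul_ite, mul_zero, ← AddChar.map_add_eq_mul]
    have : a.1 = q - (t + b.1) ↔ a.1 + b.1 = q - t := by
      constructor <;> intro h <;> linear_combination h
    simp only [this]
    split_ifs with h
    · have : q = t + a.1 + b.1 := by linear_combination -h
      subst this; congr 1; ring
    · rfl
  · intro x _ hx
    have : ¬ b.1 = x - t := fun h => hx (by rw [h]; ring)
    simp [weylAt_apply, this]
  · simp

theorem weylAt_zero {d : ℕ} [NeZero d] : weylAt (0 : ZMod d × ZMod d) = 1 := by
  ext q t
  simp [weylAt_apply, Matrix.one_apply, eq_comm (a := (0 : ZMod d)), sub_eq_zero]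

theorem weylAt_conjTranspose {d : ℕ} [NeZero d] (a : ZMod d × ZMod d) :
    (weylAt a)ᴴ = weylAt (-a) := by
  ext q t
  rw [Matrix.conjTranspose_apply, weylAt_apply, weylAt_apply]
  have : a.1 = t - q ↔ (-a).1 = q - t := by rw [Prod.fst_neg, neg_eq_iff_eq_neg, neg_sub]
  simp only [this]
  split_ifs
  · rw [conj_phase]; congr 1; simp; ring
  · simp

theorem weylAt_inv {d : ℕ} [NeZero d] (a : ZMod d × ZMod d) : (weylAt a)⁻¹ = weylAt (-a) := by
  apply Matrix.inv_eq_right_inv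
  rw [weylAt_mul, add_neg_cancel, weylAt_zero]
  simp [symp, mul_comm]

theorem trace_weylAt {d : ℕ} [Fact d.Prime] (hd : d % 4 = 3) (a : ZMod d × ZMod d) :
    (weylAt a).trace = if a = 0 then (d : ℂ) else 0 := by
  simp only [Matrix.trace, Matrix.diag_apply, weylAt_apply, sub_self]
  rcases eq_or_ne a.1 0 with h | h
  · have : ∀ x : ZMod d, a.2 * (x + x) = x * (2 * a.2) := fun x => by ring
    simp only [h, if_true, this, sum_phase_mul hd, mul_eq_zero, two_ne_zero_zmod hd, false_or,
      Prod.ext_iff, Prod.fst_zero, Prod.snd_zero, true_and]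
  · simp [h, Prod.ext_iff]

theorem trace_weylAt_mul {d : ℕ} [Fact d.Prime] (hd : d % 4 = 3) (a b : ZMod d × ZMod d) :
    (weylAt a * weylAt b).trace = if b = -a then (d : ℂ) else 0 := by
  have h : a + b = 0 ↔ b = -a := by rw [← neg_eq_iff_add_eq_zero, eq_comm]
  rw [weylAt_mul, Matrix.trace_smul, trace_weylAt hd]
  simp only [h]
  split_ifs with h
  · subst h; simp [symp, mul_comm]
  · simp

/-- The Weyl–Heisenberg matrices form an orthogonal basis for the trace form. -/
theorem sum_trace_mul_weylAt {d : ℕ} [Fact d.Prime] (hd : d % 4 = 3)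
    (ρ : Matrix (ZMod d) (ZMod d) ℂ) :
    ∑ a : ZMod d × ZMod d, (ρ * weylAt (-a)).trace • weylAt a = (d : ℂ) • ρ := by
  ext q t
  have h1 : ∀ a : ZMod d × ZMod d, (ρ * weylAt (-a)).trace =
      ∑ x, ρ (x + a.1) x * phase d (-a.2 * (2 * x + a.1)) := by
    intro a
    simp only [Matrix.trace, Matrix.diag_apply, Matrix.mul_apply]
    rw [Finset.sum_comm]
    apply Finset.sum_congr rfl
    intro x _
    rw [Finset.sum_eq_single (x + a.1)]
    · rw [weylAt_apply, if_pos (by simp)]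
      simp only [Prod.snd_neg]; congr 2; ring
    · intro y _ hy
      rw [weylAt_apply, if_neg, mul_zero]
      intro h
      simp only [Prod.fst_neg] at h
      exact hy (by linear_combination h)
    · simp
  simp only [Matrix.sum_apply, Matrix.smul_apply, smul_eq_mul, h1, Fintype.sum_prod_type]
  rw [Finset.sum_eq_single (q - t)]
  · have h2 : ∀ x s : ZMod d, phase d (-s * (2 * x + (q - t))) * phase d (s * (q + t)) =
        phase d (s * (2 * (t - x))) := by
      intro x s; rw [← AddChar.map_add_eq_mul]; congr 1; ring
    simp only [weylAt_apply, if_true, Finset.sum_mul, mul_assoc, h2]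
    rw [Finset.sum_comm]
    simp only [← Finset.mul_sum, sum_phase_mul hd, mul_eq_zero, two_ne_zero_zmod hd, false_or,
      sub_eq_zero]
    simp [mul_comm]
  · intro r _ hr
    simp [weylAt_apply, hr]
  · simp

/-! ### Level sets of the quadratic form -/

/-- The quadratic form `r² + s²` on the discrete phase space. -/
def sqNorm {d : ℕ} (a : ZMod d × ZMod d) : ZMod d := a.1 ^ 2 + a.2 ^ 2

theorem sqNorm_neg {d : ℕ} (a : ZMod d × ZMod d) : sqNorm (-a) = sqNorm a := by
  simp [sqNorm]

/-- A nontrivial zero would make `-1` a square. Here `d ≡ 3 mod 4` matters, beyond `d` being odd. -/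
theorem sqNorm_eq_zero {d : ℕ} [Fact d.Prime] (hd : d % 4 = 3) {a : ZMod d × ZMod d} :
    sqNorm a = 0 ↔ a = 0 := by
  constructor
  · intro h
    have key : ∀ x y : ZMod d, x ^ 2 + y ^ 2 = 0 → x = 0 := by
      intro x y hxy
      by_contra hx
      have : IsSquare (-1 : ZMod d) := ⟨y / x, by field_simp; linear_combination -hxy⟩
      exact ZMod.exists_sq_eq_neg_one_iff.1 this hd
    exact Prod.ext (key _ _ h) (key a.2 a.1 (by rw [add_comm]; exact h))
  · rintro rfl; simp [sqNorm]

/-- Number of points of the discrete phase space of given squared norm. -/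
def levelCard {d : ℕ} [NeZero d] (N : ZMod d) : ℕ :=
  (Finset.univ.filter fun a : ZMod d × ZMod d => sqNorm a = N).card

theorem levelCard_zero {d : ℕ} [Fact d.Prime] (hd : d % 4 = 3) :
    levelCard (0 : ZMod d) = 1 := by
  simp [levelCard, sqNorm_eq_zero hd, Finset.filter_eq']

/-- Write `M = x² + y²`: multiplication by `x + iy` multiplies the norm by `M` and is injective. -/
theorem levelCard_le_mul {d : ℕ} [Fact d.Prime] {M N : ZMod d} (hM : M ≠ 0) :
    levelCard N ≤ levelCard (M * N) := by
  obtain ⟨x, y, hxy⟩ := ZMod.sq_add_sq d M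
  apply Finset.card_le_card_of_injOn
    (fun a : ZMod d × ZMod d => (x * a.1 - y * a.2, y * a.1 + x * a.2))
  · intro a ha
    rw [Finset.mem_coe, Finset.mem_filter] at ha ⊢
    refine ⟨Finset.mem_univ _, ?_⟩
    rw [← hxy, ← ha.2, sqNorm, sqNorm]; ring
  · intro a _ b _ hab
    simp only [Prod.mk.injEq] at hab
    obtain ⟨h1, h2⟩ := hab
    ext
    · apply mul_left_cancel₀ hM; rw [← hxy]; linear_combination x * h1 + y * h2
    · apply mul_left_cancel₀ hM; rw [← hxy]; linear_combination x * h2 - y * h1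

/-- The `d - 1` nonzero levels are equinumerous and share `d² - 1` points. -/
theorem levelCard_of_ne_zero {d : ℕ} [Fact d.Prime] (hd : d % 4 = 3) {N : ZMod d} (hN : N ≠ 0) :
    levelCard N = d + 1 := by
  have heq : ∀ M : ZMod d, M ≠ 0 → levelCard M = levelCard N := by
    intro M hM
    apply le_antisymm
    · have := levelCard_le_mul (M := N / M) (N := M) (div_ne_zero hN hM)
      rwa [div_mul_cancel₀ _ hM] at this
    · have := levelCard_le_mul (M := M / N) (N := N) (div_ne_zero hM hN)
      rwa [div_mul_cancel₀ _ hN] at this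
  have htot : ∑ M : ZMod d, levelCard M = d * d := by
    have := Finset.sum_fiberwise (Finset.univ : Finset (ZMod d × ZMod d)) sqNorm (fun _ => 1)
    simpa [levelCard, ZMod.card] using this
  rw [← Finset.add_sum_erase _ _ (Finset.mem_univ (0 : ZMod d)), levelCard_zero hd,
    Finset.sum_congr rfl fun M hM => heq M (Finset.ne_of_mem_erase hM), Finset.sum_const,
    Finset.card_erase_of_mem (Finset.mem_univ _), Finset.card_univ, ZMod.card, smul_eq_mul] at htot
  obtain ⟨k, rfl⟩ : ∃ k, d = k + 1 := ⟨d - 1, by have := (Fact.out : d.Prime).one_lt; omega⟩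
  have hk : 0 < k := by have := (Fact.out : (k + 1).Prime).one_lt; omega
  rw [Nat.add_sub_cancel] at htot
  apply Nat.eq_of_mul_eq_mul_left hk
  nlinarith

/-! ### The commutative algebra of radial matrices -/

/-- The combination of Weyl–Heisenberg matrices whose coefficients depend on `r² + s²` only. -/
def radial {d : ℕ} [NeZero d] :
    (ZMod d → ℂ) →ₗ[ℂ] Matrix (ZMod d) (ZMod d) ℂ :=
  ∑ a : ZMod d × ZMod d, (LinearMap.proj (sqNorm a)).smulRight (weylAt a)

theorem radial_apply {d : ℕ} [NeZero d] (f : ZMod d → ℂ) :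
    radial f = ∑ a : ZMod d × ZMod d, f (sqNorm a) • weylAt a := by
  simp [radial, LinearMap.sum_apply]

/-- The reflection of the discrete phase space fixing `c`. -/
def refl {d : ℕ} [Fact d.Prime] (c a : ZMod d × ZMod d) : ZMod d × ZMod d :=
  (2 * (a.1 * c.1 + a.2 * c.2) / sqNorm c) • c - a

theorem sqNorm_refl_of_ne {d : ℕ} [Fact d.Prime] {c : ZMod d × ZMod d} (hc : sqNorm c ≠ 0)
    (a : ZMod d × ZMod d) : sqNorm (refl c a) = sqNorm a ∧
      sqNorm (c - refl c a) = sqNorm (c - a) ∧ symp (refl c a) c = - symp a c ∧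
      refl c (refl c a) = a := by
  obtain ⟨x, y⟩ := c
  obtain ⟨u, v⟩ := a
  simp only [sqNorm] at hc
  simp only [sqNorm, refl, symp, Prod.ext_iff, Prod.fst_sub, Prod.snd_sub, Prod.smul_fst,
    Prod.smul_snd, smul_eq_mul]
  refine ⟨?_, ?_, ?_, ?_, ?_⟩ <;> field_simp <;> ring

theorem refl_spec {d : ℕ} [Fact d.Prime] (hd : d % 4 = 3) (c a : ZMod d × ZMod d) :
    sqNorm (refl c a) = sqNorm a ∧ sqNorm (c - refl c a) = sqNorm (c - a) ∧
      symp (refl c a) c = - symp a c ∧ refl c (refl c a) = a := by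
  rcases eq_or_ne c 0 with rfl | hc
  · simp [refl, symp, sqNorm]
  · exact sqNorm_refl_of_ne (mt (sqNorm_eq_zero hd).1 hc) a

theorem radial_mul {d : ℕ} [NeZero d] (f g : ZMod d → ℂ) :
    radial f * radial g = ∑ c : ZMod d × ZMod d,
      (∑ a, f (sqNorm a) * g (sqNorm (c - a)) * phase d (symp a c)) • weylAt c := by
  simp only [radial_apply, Finset.sum_mul_sum, Finset.sum_smul]
  conv_rhs => rw [Finset.sum_comm]
  apply Finset.sum_congr rfl
  intro a _
  conv_rhs => rw [← Equiv.sum_comp (Equiv.addLeft a)]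
  apply Finset.sum_congr rfl
  intro b _
  simp only [Equiv.coe_addLeft, add_sub_cancel_left, smul_mul_smul_comm, weylAt_mul, smul_smul]
  congr 3
  simp only [symp, Prod.fst_add, Prod.snd_add]; ring

/-- The coefficient of `W_c` is a twisted convolution. The substitution `a ↦ c - a` exchanges `f`
and `g` but inverts the phase; the reflection fixing `c` preserves both norms and restores the
phase. -/
theorem radial_mul_comm {d : ℕ} [Fact d.Prime] (hd : d % 4 = 3) (f g : ZMod d → ℂ) :
    radial f * radial g = radial g * radial f := by
  rw [radial_mul, radial_mul]
  apply Finset.sum_congr rfl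
  intro c _
  congr 1
  have hr : Function.Involutive (refl c) := fun a => (refl_spec hd c a).2.2.2
  rw [← Equiv.sum_comp hr.toPerm, ← Equiv.sum_comp (Equiv.subLeft c)]
  apply Finset.sum_congr rfl
  intro a _
  obtain ⟨h1, h2, h3, -⟩ := refl_spec hd c (c - a)
  simp only [Function.Involutive.coe_toPerm, Equiv.subLeft_apply, h1, h2, h3, sub_sub_cancel]
  rw [mul_comm (f _)]
  congr 2
  simp only [symp, Prod.fst_sub, Prod.snd_sub]; ring

theorem sum_sqNorm {d : ℕ} [NeZero d] (f : ZMod d → ℂ) :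
    ∑ a : ZMod d × ZMod d, f (sqNorm a) = ∑ N, (levelCard N : ℂ) * f N := by
  rw [← Finset.sum_fiberwise _ sqNorm]
  apply Finset.sum_congr rfl
  intro N _
  rw [Finset.sum_congr rfl fun a ha => by rw [(Finset.mem_filter.1 ha).2], Finset.sum_const,
    nsmul_eq_mul, levelCard]

/-- The trace pairs `W_a` only with `W_{-a}`, which lies on the same level. -/
theorem trace_radial_mul {d : ℕ} [Fact d.Prime] (hd : d % 4 = 3) (f g : ZMod d → ℂ) :
    (radial f * radial g).trace = d * ∑ N, (levelCard N : ℂ) * (f N * g N) := by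
  simp only [radial_apply, Finset.sum_mul_sum, Matrix.trace_sum, smul_mul_smul_comm,
    Matrix.trace_smul, trace_weylAt_mul hd, smul_eq_mul, mul_ite, mul_zero, Finset.sum_ite_eq',
    Finset.mem_univ, if_true, sqNorm_neg]
  rw [sum_sqNorm fun N => f N * g N * (d : ℂ), Finset.mul_sum]
  apply Finset.sum_congr rfl
  intro N _; ring

theorem radial_isHermitian {d : ℕ} [NeZero d] (f : ZMod d → ℂ) (hf : ∀ N, star (f N) = f N) :
    (radial f).IsHermitian := by
  rw [Matrix.IsHermitian, radial_apply, Matrix.conjTranspose_sum]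
  simp only [Matrix.conjTranspose_smul, weylAt_conjTranspose, hf]
  rw [← Equiv.sum_comp (Equiv.neg _)]
  simp [sqNorm_neg]

theorem rMat_eq_radial {d : ℕ} [Fact d.Prime] (hd : d % 4 = 3) (m : ℕ) :
    rMat d m = radial fun N : ZMod d => (1 / (d : ℂ)) * phase d (m * N) := by
  rw [rMat, radial_apply, Fintype.sum_prod_type, Finset.smul_sum]
  simp only [Finset.smul_sum, smul_smul, weyl_eq_weylAt hd, tau_pow hd, sqNorm]
  simp

/-- Fourier inversion in `m`: common eigenvectors of the `R_m` are eigenvectors of the level sums.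
-/
theorem radial_single_eq_sum_rMat {d : ℕ} [Fact d.Prime] (hd : d % 4 = 3) (N : ZMod d) :
    radial (Pi.single N 1) = ∑ m : ZMod d, phase d (-(m * N)) • rMat d m.val := by
  have hd0 : (d : ℂ) ≠ 0 := Nat.cast_ne_zero.2 (NeZero.ne d)
  simp only [rMat_eq_radial hd, ← map_smul, ← map_sum]
  congr 1
  ext M
  have : ∀ m : ZMod d, phase d (-(m * N)) * (1 / (d : ℂ) * phase d (m * M)) =
      1 / (d : ℂ) * phase d (m * (M - N)) := by
    intro m
    rw [mul_left_comm, ← AddChar.map_add_eq_mul]; congr 2; ring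
  simp only [Finset.sum_apply, Pi.smul_apply, smul_eq_mul, ZMod.natCast_zmod_val, this,
    ← Finset.mul_sum, sum_phase_mul hd, sub_eq_zero, Pi.single_apply]
  split_ifs <;> simp [hd0]

/-! ### Eigenvalues and eigenprojections -/

theorem toEuclideanLin_proj {d : ℕ} [NeZero d] (v u : EuclideanSpace ℂ (ZMod d)) :
    Matrix.toEuclideanLin (proj v) u = inner ℂ v u • v := by
  ext q
  simp only [Matrix.toLpLin_apply, Matrix.mulVec, dotProduct, proj, Matrix.of_apply,
    PiLp.inner_apply, PiLp.smul_apply, smul_eq_mul, Finset.sum_mul, RCLike.inner_apply]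
  apply Finset.sum_congr rfl
  intro r _
  rw [starRingEnd_apply]; ring

theorem trace_proj {d : ℕ} [NeZero d] {v : EuclideanSpace ℂ (ZMod d)} (hv : ‖v‖ = 1) :
    (proj v).trace = 1 := by
  have h : inner ℂ v v = (1 : ℂ) := by rw [inner_self_eq_norm_sq_to_K, hv]; simp
  rw [← h, PiLp.inner_apply]
  simp only [Matrix.trace, proj, Matrix.diag_apply, Matrix.of_apply, RCLike.inner_apply,
    starRingEnd_apply]

theorem eq_sum_smul_proj {d : ℕ} [NeZero d]
    (ψ : OrthonormalBasis (Fin d) ℂ (EuclideanSpace ℂ (ZMod d)))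
    {A : Matrix (ZMod d) (ZMod d) ℂ} {μ : Fin d → ℂ}
    (h : ∀ i, Matrix.toEuclideanLin A (ψ i) = μ i • ψ i) : A = ∑ i, μ i • proj (ψ i) := by
  apply Matrix.toEuclideanLin.injective
  apply ψ.toBasis.ext
  intro j
  rw [ψ.coe_toBasis, h, map_sum, LinearMap.sum_apply]
  simp [toEuclideanLin_proj, orthonormal_iff_ite.1 ψ.orthonormal]

/-- `lam N i` is the eigenvalue at `ψ i` of the sum of the Weyl–Heisenberg matrices of squared
norm `N`. -/
def IsLevelEigenvalue {d : ℕ} [NeZero d]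
    (ψ : OrthonormalBasis (Fin d) ℂ (EuclideanSpace ℂ (ZMod d))) (lam : ZMod d → Fin d → ℂ) :
    Prop :=
  ∀ N i, Matrix.toEuclideanLin (radial (Pi.single N 1)) (ψ i) = lam N i • ψ i

theorem IsCommonEigenbasis.exists_isLevelEigenvalue {d : ℕ} [Fact d.Prime] (hd : d % 4 = 3)
    {ψ : OrthonormalBasis (Fin d) ℂ (EuclideanSpace ℂ (ZMod d))} (h : IsCommonEigenbasis d ψ) :
    ∃ lam, IsLevelEigenvalue ψ lam := by
  choose μ hμ using h
  refine ⟨fun N i => ∑ m : ZMod d, phase d (-(m * N)) * μ m.val m.val_lt i, fun N i => ?_⟩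
  rw [radial_single_eq_sum_rMat hd, map_sum, LinearMap.sum_apply, Finset.sum_smul]
  apply Finset.sum_congr rfl
  intro m _
  rw [map_smul, LinearMap.smul_apply, (hμ m.val m.val_lt i).apply_eq_smul, smul_smul]

theorem radial_eq_sum_single {d : ℕ} [NeZero d] (f : ZMod d → ℂ) :
    radial f = ∑ N, f N • radial (Pi.single N 1) := by
  conv_lhs => rw [pi_eq_sum_univ' f]
  simp only [map_sum, map_smul, Pi.single]

theorem IsLevelEigenvalue.radial_apply {d : ℕ} [NeZero d]
    {ψ : OrthonormalBasis (Fin d) ℂ (EuclideanSpace ℂ (ZMod d))} {lam : ZMod d → Fin d → ℂ}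
    (h : IsLevelEigenvalue ψ lam) (f : ZMod d → ℂ) (i : Fin d) :
    Matrix.toEuclideanLin (radial f) (ψ i) = (∑ N, f N * lam N i) • ψ i := by
  rw [radial_eq_sum_single, map_sum, LinearMap.sum_apply, Finset.sum_smul]
  apply Finset.sum_congr rfl
  intro N _
  rw [map_smul, LinearMap.smul_apply, h, smul_smul]

theorem IsLevelEigenvalue.isCommonEigenbasis {d : ℕ} [Fact d.Prime] (hd : d % 4 = 3)
    {ψ : OrthonormalBasis (Fin d) ℂ (EuclideanSpace ℂ (ZMod d))} {lam : ZMod d → Fin d → ℂ}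
    (h : IsLevelEigenvalue ψ lam) : IsCommonEigenbasis d ψ := by
  intro m _ i
  refine ⟨∑ N, (1 / (d : ℂ)) * phase d (m * N) * lam N i, Module.End.hasEigenvector_iff.2
    ⟨Module.End.mem_eigenspace_iff.2 ?_, ψ.orthonormal.ne_zero i⟩⟩
  rw [rMat_eq_radial hd]
  exact h.radial_apply _ i

/-- Both sides compute the trace of a product of two level sums. -/
theorem IsLevelEigenvalue.sum_mul {d : ℕ} [Fact d.Prime] (hd : d % 4 = 3)
    {ψ : OrthonormalBasis (Fin d) ℂ (EuclideanSpace ℂ (ZMod d))} {lam : ZMod d → Fin d → ℂ}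
    (h : IsLevelEigenvalue ψ lam) (M N : ZMod d) :
    ∑ i, lam M i * lam N i = if M = N then (d : ℂ) * levelCard N else 0 := by
  have h1 : radial (Pi.single M 1) * radial (Pi.single N 1) =
      ∑ i, (lam M i * lam N i) • proj (ψ i) := by
    apply eq_sum_smul_proj
    intro i
    rw [Matrix.toLpLin_mul_same, LinearMap.comp_apply, h, map_smul, h, smul_smul, mul_comm]
  have h2 := trace_radial_mul hd (Pi.single M 1) (Pi.single N 1)
  rw [h1, Matrix.trace_sum] at h2
  simp only [Matrix.trace_smul, trace_proj (ψ.orthonormal.1 _), smul_eq_mul, mul_one] at h2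
  rw [h2, Finset.sum_eq_single N]
  · rcases eq_or_ne M N with rfl | hMN
    · simp
    · simp [hMN]
  · intro x _ hx
    simp [hx]
  · simp

theorem levelCard_ne_zero {d : ℕ} [Fact d.Prime] (hd : d % 4 = 3) (N : ZMod d) :
    (levelCard N : ℂ) ≠ 0 := by
  rcases eq_or_ne N 0 with rfl | hN
  · simp [levelCard_zero hd]
  · rw [levelCard_of_ne_zero hd hN]; exact_mod_cast Nat.succ_ne_zero d

/-- A one-sided inverse of a square matrix is two-sided, so orthogonality of the rows of `lam`
passes to its columns. -/
theorem IsLevelEigenvalue.sum_div_mul {d : ℕ} [Fact d.Prime] (hd : d % 4 = 3)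
    {ψ : OrthonormalBasis (Fin d) ℂ (EuclideanSpace ℂ (ZMod d))} {lam : ZMod d → Fin d → ℂ}
    (h : IsLevelEigenvalue ψ lam) (i j : Fin d) :
    ∑ N, lam N i / (d * levelCard N) * lam N j = if i = j then 1 else 0 := by
  have hd0 : (d : ℂ) ≠ 0 := Nat.cast_ne_zero.2 (NeZero.ne d)
  have h1 : (Matrix.of lam : Matrix (ZMod d) (Fin d) ℂ) *
      (Matrix.of fun i N => lam N i / (d * levelCard N) : Matrix (Fin d) (ZMod d) ℂ) = 1 := by
    ext M N
    simp only [Matrix.mul_apply, Matrix.of_apply, ← mul_div_assoc, ← Finset.sum_div,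
      h.sum_mul hd, Matrix.one_apply]
    split_ifs
    · exact div_self (mul_ne_zero hd0 (levelCard_ne_zero hd N))
    · simp
  have h2 := (Matrix.mul_eq_one_comm_of_card_eq _ _ _ (by simp [ZMod.card])).1 h1
  simpa [Matrix.mul_apply, Matrix.one_apply] using congrFun (congrFun h2 i) j

/-- By column orthogonality the right side has eigenvalue `δ_ij` at `ψ j`. -/
theorem IsLevelEigenvalue.proj_eq_radial {d : ℕ} [Fact d.Prime] (hd : d % 4 = 3)
    {ψ : OrthonormalBasis (Fin d) ℂ (EuclideanSpace ℂ (ZMod d))} {lam : ZMod d → Fin d → ℂ}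
    (h : IsLevelEigenvalue ψ lam) (i : Fin d) :
    proj (ψ i) = radial fun N => lam N i / (d * levelCard N) := by
  rw [eq_sum_smul_proj ψ (h.radial_apply _)]
  simp [h.sum_div_mul hd]

/-! ### Existence and uniqueness of the basis -/

theorem exists_isCommonEigenbasis {d : ℕ} [Fact d.Prime] (hd : d % 4 = 3) :
    ∃ ψ : OrthonormalBasis (Fin d) ℂ (EuclideanSpace ℂ (ZMod d)), IsCommonEigenbasis d ψ := by
  classical
  let T : ZMod d → Module.End ℂ (EuclideanSpace ℂ (ZMod d)) := fun N =>
    Matrix.toEuclideanLin (radial (Pi.single N 1))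
  have hT : ∀ N, (T N).IsSymmetric := fun N =>
    Matrix.isSymmetric_toEuclideanLin_iff.2 (radial_isHermitian _ fun M => by
      simp only [Pi.single_apply]; split_ifs <;> simp)
  have hc : Pairwise (Function.onFun Commute T) := by
    intro M N _
    change T M * T N = T N * T M
    rw [Module.End.mul_eq_comp, Module.End.mul_eq_comp, ← Matrix.toLpLin_mul_same,
      ← Matrix.toLpLin_mul_same, radial_mul_comm hd]
  have hI := LinearMap.IsSymmetric.directSum_isInternal_of_pairwise_commute hT hc
  have hO := LinearMap.IsSymmetric.orthogonalFamily_iInf_eigenspaces hT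
  -- Joint eigenspaces are indexed by all functions `ZMod d → ℂ`; only finitely many are nonzero,
  -- and these suffice.
  let := hI.submodule_iSupIndep.fintypeNeBotOfFiniteDimensional
  have hI' := DirectSum.isInternal_ne_bot_iff.2 hI
  have hO' := hO.comp (γ := {α // (⨅ j, (T j).eigenspace (α j)) ≠ ⊥})
    Subtype.val_injective
  have hn : Module.finrank ℂ (EuclideanSpace ℂ (ZMod d)) = d := by simp [ZMod.card]
  let ψ := hI'.subordinateOrthonormalBasis hn hO'
  have hψ : ∀ i, ∃ α : ZMod d → ℂ, ∀ N, ψ i ∈ (T N).eigenspace (α N) := fun i =>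
    ⟨_, (Submodule.mem_iInf _).1 (hI'.subordinateOrthonormalBasis_subordinate hn i hO')⟩
  choose α hα using hψ
  have hL : IsLevelEigenvalue ψ fun N i => α i N := fun N i =>
    Module.End.mem_eigenspace_iff.1 (hα i N)
  exact ⟨ψ, hL.isCommonEigenbasis hd⟩

/-- The projection onto `φ j` is radial, so it scales each `ψ i`; yet its image is spanned by `φ j`.
Any `ψ i` not orthogonal to `φ j` is thus parallel to it. -/
theorem IsCommonEigenbasis.exists_eq_smul {d : ℕ} [Fact d.Prime] (hd : d % 4 = 3)
    {ψ φ : OrthonormalBasis (Fin d) ℂ (EuclideanSpace ℂ (ZMod d))}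
    (hψ : IsCommonEigenbasis d ψ) (hφ : IsCommonEigenbasis d φ) (j : Fin d) :
    ∃ (i : Fin d) (c : ℂ), φ j = c • ψ i := by
  obtain ⟨lam, hlam⟩ := hψ.exists_isLevelEigenvalue hd
  obtain ⟨mu, hmu⟩ := hφ.exists_isLevelEigenvalue hd
  obtain ⟨i, hi⟩ : ∃ i, inner ℂ (φ j) (ψ i) ≠ (0 : ℂ) := by
    by_contra! h
    apply φ.orthonormal.ne_zero j
    rw [← ψ.sum_repr' (φ j)]
    exact Finset.sum_eq_zero fun i _ => by rw [inner_eq_zero_symm.1 (h i), zero_smul]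
  have h := hlam.radial_apply (fun N => mu N j / (d * levelCard N)) i
  rw [← hmu.proj_eq_radial hd, toEuclideanLin_proj] at h
  exact ⟨i, _, by rw [← inv_smul_smul₀ hi (φ j), h, smul_smul]⟩

theorem IsCommonEigenbasis.unique {d : ℕ} [Fact d.Prime] (hd : d % 4 = 3)
    {ψ φ : OrthonormalBasis (Fin d) ℂ (EuclideanSpace ℂ (ZMod d))}
    (hψ : IsCommonEigenbasis d ψ) (hφ : IsCommonEigenbasis d φ) :
    ∃ (σ : Equiv.Perm (Fin d)) (c : Fin d → ℂ), ∀ i, ‖c i‖ = 1 ∧ φ i = c i • ψ (σ i) := by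
  choose s c hs using hψ.exists_eq_smul hd hφ
  have hc : ∀ i, ‖c i‖ = 1 := fun i => by
    have := congrArg norm (hs i)
    rwa [norm_smul, φ.orthonormal.1, ψ.orthonormal.1, mul_one, eq_comm] at this
  have hinj : Function.Injective s := by
    intro i j hij
    by_contra hne
    have h0 : inner ℂ (φ i) (φ j) = (0 : ℂ) := φ.orthonormal.2 hne
    rw [hs i, hs j, hij, inner_smul_left, inner_smul_right, inner_self_eq_norm_sq_to_K,
      ψ.orthonormal.1] at h0
    have hi := hc i
    have hj := hc j
    simp only [RCLike.ofReal_one, one_pow, mul_one, mul_eq_zero, map_eq_zero] at h0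
    rcases h0 with h0 | h0 <;> simp [h0] at hi hj
  exact ⟨Equiv.ofBijective s (Finite.injective_iff_bijective.1 hinj), c, fun i => ⟨hc i, hs i⟩⟩

/-! ### Averaging over phase space and reconstruction -/

theorem weylAt_conj {d : ℕ} [NeZero d] (k a : ZMod d × ZMod d) :
    weylAt k * weylAt a * (weylAt k)⁻¹ = phase d (2 * symp k a) • weylAt a := by
  rw [weylAt_inv, weylAt_mul, Matrix.smul_mul, weylAt_mul, smul_smul, ← AddChar.map_add_eq_mul,
    add_neg_cancel_comm]
  congr 2
  simp only [symp, Prod.fst_add, Prod.snd_add, Prod.fst_neg, Prod.snd_neg]; ring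

theorem sum_phase_symp {d : ℕ} [Fact d.Prime] (hd : d % 4 = 3) (a : ZMod d × ZMod d) :
    ∑ k : ZMod d × ZMod d, phase d (2 * symp k a) = if a = 0 then (d : ℂ) ^ 2 else 0 := by
  have h : ∀ k l : ZMod d, phase d (2 * symp (k, l) a) =
      phase d (k * (2 * -a.2)) * phase d (l * (2 * a.1)) := by
    intro k l; rw [← AddChar.map_add_eq_mul]; congr 1; simp only [symp]; ring
  simp only [Fintype.sum_prod_type, h, ← Finset.mul_sum, ← Finset.sum_mul, sum_phase_mul hd,
    mul_eq_zero, two_ne_zero_zmod hd, false_or, neg_eq_zero, Prod.ext_iff, Prod.fst_zero,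
    Prod.snd_zero]
  split_ifs <;> simp_all [sq]

/-- Conjugation by `W_k` multiplies `W_a` by a character of `k`, so in the double expansion only the
pairs `(-a, a)` survive the sum over `k`. -/
theorem sum_conj_radial {d : ℕ} [Fact d.Prime] (hd : d % 4 = 3) (f : ZMod d → ℂ)
    (ρ : Matrix (ZMod d) (ZMod d) ℂ) :
    ∑ k : ZMod d × ZMod d, (ρ * (weylAt k * radial f * (weylAt k)⁻¹)).trace •
        (weylAt k * radial f * (weylAt k)⁻¹) =
      ∑ a, ((d : ℂ) ^ 2 * (f (sqNorm a) ^ 2)) • (ρ * weylAt (-a)).trace • weylAt a := by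
  have h1 : ∀ k : ZMod d × ZMod d, weylAt k * radial f * (weylAt k)⁻¹ =
      ∑ a, (f (sqNorm a) * phase d (2 * symp k a)) • weylAt a := by
    intro k
    simp only [radial_apply, Finset.mul_sum, Finset.sum_mul, Matrix.mul_smul, Matrix.smul_mul,
      weylAt_conj, smul_smul]
  have h2 : ∀ k a b : ZMod d × ZMod d, phase d (2 * symp k a) * phase d (2 * symp k b) =
      phase d (2 * symp k (a + b)) := by
    intro k a b
    rw [← AddChar.map_add_eq_mul]; congr 1
    simp only [symp, Prod.fst_add, Prod.snd_add]; ring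
  have h3 : ∀ k : ZMod d × ZMod d, (ρ * (weylAt k * radial f * (weylAt k)⁻¹)).trace •
        (weylAt k * radial f * (weylAt k)⁻¹) =
      ∑ a, ∑ b, phase d (2 * symp k (b + a)) •
        ((f (sqNorm b) * f (sqNorm a)) • (ρ * weylAt b).trace • weylAt a) := by
    intro k
    rw [h1, Finset.smul_sum]
    apply Finset.sum_congr rfl
    intro a _
    simp only [Finset.mul_sum, Matrix.trace_sum, Finset.sum_smul]
    apply Finset.sum_congr rfl
    intro b _
    rw [Matrix.mul_smul, Matrix.trace_smul, ← h2]
    simp only [smul_smul, smul_eq_mul]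
    congr 1; ring
  simp only [h3]
  rw [Finset.sum_comm]
  apply Finset.sum_congr rfl
  intro a _
  rw [Finset.sum_comm, Finset.sum_eq_single (-a)]
  · rw [← Finset.sum_smul, sum_phase_symp hd, if_pos (neg_add_cancel a), sqNorm_neg]
    simp only [smul_smul]
    congr 1; ring
  · intro b _ hb
    rw [← Finset.sum_smul, sum_phase_symp hd, if_neg (mt eq_neg_of_add_eq_zero_left hb), zero_smul]
  · simp

theorem IsCommonEigenbasis.reconstruction {d : ℕ} [Fact d.Prime] (hd : d % 4 = 3)
    {ψ : OrthonormalBasis (Fin d) ℂ (EuclideanSpace ℂ (ZMod d))} (hψ : IsCommonEigenbasis d ψ)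
    {ρ : Matrix (ZMod d) (ZMod d) ℂ} (hρ : ρ.trace = 1) :
    ρ = ((d : ℂ) + 1) • (∑ i : Fin d, ∑ k : ZMod d, ∑ l : ZMod d,
      ((1 / (d : ℂ) ^ 2) * (ρ * projTranslate (ψ i) k l).trace) • projTranslate (ψ i) k l) - 1 := by
  have hd0 : (d : ℂ) ≠ 0 := Nat.cast_ne_zero.2 (NeZero.ne d)
  obtain ⟨lam, hlam⟩ := hψ.exists_isLevelEigenvalue hd
  have hi : ∀ i, ∑ k : ZMod d, ∑ l : ZMod d,
      ((1 / (d : ℂ) ^ 2) * (ρ * projTranslate (ψ i) k l).trace) • projTranslate (ψ i) k l =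
      ∑ a, (lam (sqNorm a) i * lam (sqNorm a) i / (d * levelCard (sqNorm a)) ^ 2) •
        (ρ * weylAt (-a)).trace • weylAt a := by
    intro i
    have h := sum_conj_radial hd (fun N => lam N i / (d * levelCard N)) ρ
    rw [Fintype.sum_prod_type] at h
    simp only [projTranslate, weyl_eq_weylAt hd, hlam.proj_eq_radial hd, mul_smul (1 / (d : ℂ) ^ 2),
      ← Finset.smul_sum]
    rw [h, Finset.smul_sum]
    apply Finset.sum_congr rfl
    intro a _
    simp only [smul_smul]
    congr 1
    field_simp
  have hs : ∑ i : Fin d, ∑ k : ZMod d, ∑ l : ZMod d,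
      ((1 / (d : ℂ) ^ 2) * (ρ * projTranslate (ψ i) k l).trace) • projTranslate (ψ i) k l =
      ∑ a, (1 / (d * levelCard (sqNorm a) : ℂ)) • (ρ * weylAt (-a)).trace • weylAt a := by
    simp only [hi]
    rw [Finset.sum_comm]
    apply Finset.sum_congr rfl
    intro a _
    rw [← Finset.sum_smul, ← Finset.sum_div, hlam.sum_mul hd, if_pos rfl]
    congr 1
    have := levelCard_ne_zero hd (sqNorm a)
    field_simp
  have hρ' : ρ = (1 / d : ℂ) • ∑ a : ZMod d × ZMod d, (ρ * weylAt (-a)).trace • weylAt a := by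
    rw [sum_trace_mul_weylAt hd, smul_smul, one_div_mul_cancel hd0, one_smul]
  rw [hs]
  conv_lhs => rw [hρ']
  -- The point `a = 0` is split off: its level has one point, not `d + 1`, and the excess weight `(d
  -- + 1)/d - 1/d = 1` is the identity to be subtracted.
  rw [eq_sub_iff_add_eq, Finset.smul_sum, Finset.smul_sum,
    ← Finset.add_sum_erase _ _ (Finset.mem_univ (0 : ZMod d × ZMod d)),
    ← Finset.add_sum_erase _ _ (Finset.mem_univ (0 : ZMod d × ZMod d)), add_right_comm]
  congr 1
  · rw [(sqNorm_eq_zero hd).2 rfl, levelCard_zero hd, neg_zero, weylAt_zero, mul_one, hρ,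
      one_smul, smul_smul]
    conv_lhs => rw [← one_smul ℂ (1 : Matrix (ZMod d) (ZMod d) ℂ), smul_smul]
    rw [← add_smul]
    congr 1
    field_simp
    simp [add_comm]
  · apply Finset.sum_congr rfl
    intro a ha
    rw [levelCard_of_ne_zero hd (mt (sqNorm_eq_zero hd).1 (Finset.ne_of_mem_erase ha)), smul_smul ((d : ℂ) + 1)]
    congr 1
    push_cast
    field_simp

end BalianItzykson

end

theorem corollary1 (d : ℕ) [Fact d.Prime] (hd : d % 4 = 3) :
    -- the common eigenbasis exists
    (∃ ψ : OrthonormalBasis (Fin d) ℂ (EuclideanSpace ℂ (ZMod d)),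
      BalianItzykson.IsCommonEigenbasis d ψ) ∧
    -- it is unique up to the order and the phases of its vectors
    (∀ ψ φ : OrthonormalBasis (Fin d) ℂ (EuclideanSpace ℂ (ZMod d)),
      BalianItzykson.IsCommonEigenbasis d ψ → BalianItzykson.IsCommonEigenbasis d φ →
      ∃ (σ : Equiv.Perm (Fin d)) (c : Fin d → ℂ),
        ∀ i, ‖c i‖ = 1 ∧ φ i = c i • ψ (σ i)) ∧
    -- the reconstruction formula
    (∀ ψ : OrthonormalBasis (Fin d) ℂ (EuclideanSpace ℂ (ZMod d)),
      BalianItzykson.IsCommonEigenbasis d ψ →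
      ∀ ρ : Matrix (ZMod d) (ZMod d) ℂ, ρ.trace = 1 →
        ρ = ((d : ℂ) + 1) • (∑ i : Fin d, ∑ k : ZMod d, ∑ l : ZMod d,
              ((1 / (d : ℂ) ^ 2) * (ρ * BalianItzykson.projTranslate (ψ i) k l).trace) •
                BalianItzykson.projTranslate (ψ i) k l) - 1) :=
  ⟨BalianItzykson.exists_isCommonEigenbasis hd,
    fun _ _ hψ hφ => hψ.unique hd hφ,
    fun _ hψ _ hρ => hψ.reconstruction hd hρ⟩
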